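/- Fix a universe $\mathfrak U$; "small" means $\mathfrak U$-small, sheaves and presheaves are of small sets, and $\circ$ is the usual composition. **Definitions.** Let $\mathcal C$ be a category. A collection $\mathcal T$ of morphisms is *semi-localizing* if it contains all identities, is closed under composition, and for every $Y_1\xrightarrow{f_1}X\xleftarrow{f_2}Y_2$ with $f_1\in\mathcal T$ there are $g_1:Z\to Y_1$ and $g_2:Z\to Y_2$ with $g_2\in\mathcal T$ and $f_1\circ g_1=f_2\circ g_2$. A Grothendieck topology $J$ on $\mathcal C$ is an *$A$-topology* if for some semi-localizing $\mathcal T$ the covering sieves are exactly the sieves containing a member of $\mathcal T$. Let $\mathcal T(J)$ be the collection of morphisms $f:Y\to X$ that generate a covering sieve of $X$, and let $\mathcal C(\mathcal T(J))$ be the subcategory of $\mathcal C$ with all objects and with the morphisms in $\mathcal T(J)$. For a collection $\mathcal T$, let $\widehat{\mathcal T}$ be the collection of all $f$ such that $f\circ g\in\mathcal T$ for some $g$. A morphism $f:Y\to X$ is a *Galois covering* if there are a group $G$ and a homomorphism $\rho:G\to\mathrm{Aut}_X(Y)$ such that for every object $Z$ the group $G$ (acting through $\rho$ by composition) acts freely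 on $\mathrm{Hom}(Z,Y)$ and the map $G\backslash\mathrm{Hom}(Z,Y)\to\mathrm{Hom}(Z,X)$ induced by $f$ is injective. A category is *$\Lambda$-connected* if any two objects receive morphisms from a common object. The site $(\mathcal C,J)$ is a *$Y$-site* if: every morphism of $\mathcal C$ is an epimorphism; $J$ is an $A$-topology; $f\circ g\in\mathcal T(J)$ if and only if $f\in\mathcal T(J)$ and $g\in\mathcal T(J)$; $\mathcal C$ is essentially small; $\mathcal C(\mathcal T(J))$ is $\Lambda$-connected; and $\widehat{\mathcal T'}=\widehat{\mathcal T(J)}$, where $\mathcal T'$ is the collection of Galois coverings that belong to $\mathcal T(J)$. Let $\mathcal C_0$ be a small poset, regarded as a category with a unique morphism $x\to y$ when $x\le y$, and let $\iota_0:\mathcal C_0\to\mathcal C$ be a functor. An object $X$ of $\mathcal C_0$ is an *edge object* if $\iota_0(f)\in\mathcal T(J)$ for every morphism $f:Y\to X$ of $\mathcal C_0$. The pair $(\mathcal C_0,\iota_0)$ is a *grid* of $(\mathcal C,J)$ if: $\mathcal C_0$ is $\Lambda$-connected; every object of $\mathcal C$ is isomorphic to $\iota_0(X)$ for some edge object $X$;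 for every object $X$ of $\mathcal C_0$ and every $f:Y\to\iota_0(X)$ in $\mathcal T(J)$ there are $f':Y'\to X$ in $\mathcal C_0$ and an isomorphism $a:Y\cong\iota_0(Y')$ with $f=\iota_0(f')\circ a$; and for every object $X$ of $\mathcal C_0$ the functor $\mathcal C_{0,X/}\to\mathcal C_{\iota_0(X)/}$ of undercategories induced by $\iota_0$ is an equivalence. The *absolute Galois monoid* $M=M_{(\mathcal C_0,\iota_0)}$ consists of the pairs $(\alpha,\gamma_\alpha)$ of a functor $\alpha:\mathcal C_0\to\mathcal C_0$ and a natural isomorphism $\gamma_\alpha:\iota_0\cong\iota_0\circ\alpha$, with $(\alpha,\gamma_\alpha)(\beta,\gamma_\beta)=(\alpha\circ\beta,(\beta^*\gamma_\alpha)\circ\gamma_\beta)$. For an object $X$ of $\mathcal C_0$ let $\mathbb K_X\subset M$ be the submonoid of the $(\alpha,\gamma_\alpha)$ with $\alpha(X)=X$ and $\gamma_\alpha(X)=\mathrm{id}_{\iota_0(X)}$. A small left $M$-set $S$ is *smooth* if every $s\in S$ is fixed by $\mathbb K_X$ for some edge object $X$; morphisms of smooth sets are the $M$-equivariant maps. For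 a sheaf $F$ put $\omega(F)=\varinjlim_X F(\iota_0(X))$, the colimit over the edge objects $X$ of $\mathcal C_0$; it agrees with the colimit over all objects of $\mathcal C_0$, and $(\alpha,\gamma_\alpha)\in M$ acts on it by sending the class of $x\in F(\iota_0(X))$ to the class of $(\gamma_\alpha(X)^{-1})^*x\in F(\iota_0(\alpha(X)))$. This makes $\omega(F)$ a smooth $M$-set and defines the *fiber functor* $\omega$ from the category $\mathrm{Shv}(\mathcal C,J)$ of sheaves on $(\mathcal C,J)$ to the category of smooth $M$-sets. **Theorem.** Let $(\mathcal C,J)$ be a $Y$-site and let $(\mathcal C_0,\iota_0)$ be a grid of it. Then the fiber functor $\omega:\mathrm{Shv}(\mathcal C,J)\to(\text{smooth }M_{(\mathcal C_0,\iota_0)}\text{-sets})$ is faithful. If moreover, for each object $X$ of $\mathcal C$, the overcategory $\mathcal D=\mathcal C(\mathcal T(J))_{/X}$ satisfies at least one of the two conditions 1. $\mathrm{Hom}_{\mathcal D}(A,B)$ is finite for all objects $A,B$ of $\mathcal D$; 2. there is an at most countable set $S$ of objects of $\mathcal D$ such that every object of $\mathcal D$ receives a morphism from a member of $S$; then $\omega$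 is an equivalence of categories. -/

import Mathlib

open CategoryTheory CategoryTheory.Limits Opposite

universe w v u

namespace YSites

section Topology

variable {C : Type u} [Category.{v} C]

/-- A collection `T` of morphisms is semi-localizing: it contains the identities, is closed under
composition, and satisfies the right Ore condition. -/
structure IsSemiLocalizing (T : MorphismProperty C) : Prop where
  id_mem : ∀ X : C, T (𝟙 X)
  comp_mem : ∀ {X Y Z : C} (g : Z ⟶ Y) (f : Y ⟶ X), T g → T f → T (g ≫ f)
  ore : ∀ {Y₁ Y₂ X : C} (f₁ : Y₁ ⟶ X) (f₂ : Y₂ ⟶ X), T f₁ →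
    ∃ (Z : C) (g₁ : Z ⟶ Y₁) (g₂ : Z ⟶ Y₂), T g₂ ∧ g₁ ≫ f₁ = g₂ ≫ f₂

/-- `J` is an `A`-topology: for some semi-localizing `T`, the covering sieves are exactly the
sieves containing a member of `T`. -/
def IsATopology (J : GrothendieckTopology C) : Prop :=
  ∃ T : MorphismProperty C, IsSemiLocalizing T ∧
    ∀ (X : C) (R : Sieve X), R ∈ J X ↔ ∃ (Y : C) (f : Y ⟶ X), R f ∧ T f

/-- `T(J)`: the morphisms `f : Y ⟶ X` such that the sieve generated by `f` covers `X`. -/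
def coverMor (J : GrothendieckTopology C) : MorphismProperty C :=
  fun _ X f => Sieve.generate (Presieve.singleton f) ∈ J X

/-- The collection of those `f` for which `f ∘ g` lies in `T` for some `g`. -/
def hat (T : MorphismProperty C) : MorphismProperty C :=
  fun Y _ f => ∃ (Z : C) (g : Z ⟶ Y), T (g ≫ f)

instance coverMor_isMultiplicative (J : GrothendieckTopology C) :
    (coverMor J).IsMultiplicative where
  id_mem X := by
    have h : Sieve.generate (Presieve.singleton (𝟙 X)) = ⊤ :=
      (Sieve.id_mem_iff_eq_top).1 (Sieve.le_generate _ _ _ Presieve.singleton.mk)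
    show _ ∈ J X
    rw [h]
    exact J.top_mem X
  comp_mem {Z Y X} g f hg hf := by
    refine J.transitive hf _ ?_
    rintro W h ⟨V, k, m, hm, rfl⟩
    cases hm
    refine J.superset_covering ?_ (J.pullback_stable k hg)
    rintro U l ⟨V', k', m', hm', e⟩
    cases hm'
    exact ⟨_, k', _, Presieve.singleton.mk, by rw [← Category.assoc, e, Category.assoc]⟩

/-- `C(T(J))`: the subcategory of `C` with all objects and with the morphisms in `T(J)`. -/
abbrev CoverCat (J : GrothendieckTopology C) : Type u := WideSubcategory (coverMor J)

/-- Any two objects receive morphisms from a common object. -/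
def IsLambdaConnected (D : Type*) [Category* D] : Prop :=
  ∀ X Y : D, ∃ Z : D, Nonempty (Z ⟶ X) ∧ Nonempty (Z ⟶ Y)

end Topology

section Galois

/-- `φ : S → S'` is a pseudo `G`-torsor: it is `G`-invariant, `G` acts freely on `S`, and the
induced map `G \ S → S'` is injective. -/
structure IsPseudoTorsor (G : Type*) [Group G] {S S' : Type*} [MulAction G S] (φ : S → S') :
    Prop where
  invariant : ∀ (g : G) (s : S), φ (g • s) = φ s
  free : ∀ (g : G) (s : S), g • s = s → g = 1
  injective : ∀ s t : S, φ s = φ t → ∃ g : G, g • s = t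

variable {C : Type u} [Category.{v} C]

/-- A homomorphism `ρ : G → Aut_X(Y)` lets `G` act on `Hom(Z, Y)` by composition with `ρ g`. -/
@[reducible]
def homAction {X Y : C} {f : Y ⟶ X} {G : Type*} [Group G] (ρ : G →* Aut (Over.mk f)) (Z : C) :
    MulAction G (Z ⟶ Y) where
  smul g h := h ≫ (ρ g).hom.left
  one_smul h := by
    show h ≫ (ρ 1).hom.left = h
    rw [map_one]
    exact Category.comp_id h
  mul_smul a b h := by
    show h ≫ (ρ (a * b)).hom.left = (h ≫ (ρ b).hom.left) ≫ (ρ a).hom.left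
    rw [map_mul, Category.assoc]
    rfl

/-- `f : Y ⟶ X` is a Galois covering. -/
def IsGaloisCovering {X Y : C} (f : Y ⟶ X) : Prop :=
  ∃ (G : Type v) (_ : Group G) (ρ : G →* Aut (Over.mk f)), ∀ Z : C,
    letI := homAction ρ Z
    IsPseudoTorsor G (fun h : Z ⟶ Y => h ≫ f)

/-- `T` has enough Galois coverings: the collection `T'` of Galois coverings in `T` has the same
hat as `T`. -/
def HasEnoughGalois (T : MorphismProperty C) : Prop :=
  hat (fun _ _ f => T f ∧ IsGaloisCovering f) = hat T

/-- `B`-sites: every morphism is an epimorphism, `J` is an `A`-topology, and a composite is in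
`T(J)` if and only if both factors are. -/
structure IsBSite (J : GrothendieckTopology C) : Prop where
  epi : ∀ {X Y : C} (f : X ⟶ Y), Epi f
  isATopology : IsATopology J
  comp_iff : ∀ {X Y Z : C} (g : Z ⟶ Y) (f : Y ⟶ X),
    coverMor J (g ≫ f) ↔ coverMor J f ∧ coverMor J g

/-- `Y`-sites, relative to the universe `Type w` of small sets. -/
structure IsYSite (J : GrothendieckTopology C) : Prop extends IsBSite J where
  essentiallySmall : EssentiallySmall.{w} C
  lambdaConnected : IsLambdaConnected (CoverCat J)
  enoughGalois : HasEnoughGalois (coverMor J)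

/-- First cardinality condition: all hom sets are finite. -/
def HomFinite (D : Type*) [Category* D] : Prop :=
  ∀ X Y : D, Finite (X ⟶ Y)

/-- Second cardinality condition: there is an at most countable set of objects such that every object
receives a morphism from a member of that set. -/
def CountablyGenerated (D : Type*) [Category* D] : Prop :=
  ∃ S : Set D, S.Countable ∧ ∀ X : D, ∃ s ∈ S, Nonempty (s ⟶ X)

end Galois

section Grid

variable {C : Type u} [Category.{v} C]

/-- `X` is an edge object of `C₀`: `ι₀ f` is in `T(J)` for every morphism `f : Y ⟶ X` of `C₀`. -/
def IsEdge (J : GrothendieckTopology C) {C₀ : Type w} [PartialOrder C₀] (ι₀ : C₀ ⥤ C) :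
    ObjectProperty C₀ :=
  fun X => ∀ (Y : C₀) (f : Y ⟶ X), coverMor J (ι₀.map f)

/-- `(C₀, ι₀)` is a grid of `(C, J)`; the poset `C₀` is regarded as a category with a unique
morphism `x ⟶ y` whenever `x ≤ y`. -/
structure IsGrid (J : GrothendieckTopology C) {C₀ : Type w} [PartialOrder C₀] (ι₀ : C₀ ⥤ C) :
    Prop where
  lambdaConnected : IsLambdaConnected C₀
  exists_edge : ∀ X' : C, ∃ X : C₀, IsEdge J ι₀ X ∧ Nonempty (ι₀.obj X ≅ X')
  exists_lift : ∀ (X : C₀) {Y : C} (f : Y ⟶ ι₀.obj X), coverMor J f →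
    ∃ (Y' : C₀) (f' : Y' ⟶ X) (a : Y ≅ ι₀.obj Y'), f = a.hom ≫ ι₀.map f'
  under_equivalence : ∀ X : C₀, (Under.post ι₀ : Under X ⥤ Under (ι₀.obj X)).IsEquivalence

/-- The underlying set of the absolute Galois monoid of `(C₀, ι₀)`. -/
structure GaloisMonoid {C₀ : Type w} [PartialOrder C₀] (ι₀ : C₀ ⥤ C) where
  /-- an endofunctor of `C₀` -/
  α : C₀ ⥤ C₀
  /-- a natural isomorphism from `ι₀` to `ι₀ ∘ α` -/
  γ : ι₀ ≅ α ⋙ ι₀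

variable {C₀ : Type w} [PartialOrder C₀] {ι₀ : C₀ ⥤ C}

namespace GaloisMonoid

/-- `(α, γ_α) ∘ (β, γ_β) = (α ∘ β, (β^* γ_α) ∘ γ_β)` -/
instance : Mul (GaloisMonoid ι₀) where
  mul a b :=
    ⟨b.α ⋙ a.α, b.γ ≪≫ Functor.isoWhiskerLeft b.α a.γ ≪≫ (Functor.associator _ _ _).symm⟩

instance : One (GaloisMonoid ι₀) where
  one := ⟨𝟭 C₀, (Functor.leftUnitor ι₀).symm⟩

theorem mul_α (a b : GaloisMonoid ι₀) : (a * b).α = b.α ⋙ a.α := rfl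

theorem one_α : (1 : GaloisMonoid ι₀).α = 𝟭 C₀ := rfl

theorem mul_γ_hom_app (a b : GaloisMonoid ι₀) (X : C₀) :
    (a * b).γ.hom.app X = b.γ.hom.app X ≫ a.γ.hom.app (b.α.obj X) :=
  congrArg (b.γ.hom.app X ≫ ·) (Category.comp_id (a.γ.hom.app (b.α.obj X)))

theorem mul_γ_inv_app (a b : GaloisMonoid ι₀) (X : C₀) :
    (a * b).γ.inv.app X = a.γ.inv.app (b.α.obj X) ≫ b.γ.inv.app X :=
  congrArg (· ≫ b.γ.inv.app X) (Category.id_comp (a.γ.inv.app (b.α.obj X)))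

theorem one_γ_hom_app (X : C₀) : (1 : GaloisMonoid ι₀).γ.hom.app X = 𝟙 (ι₀.obj X) := rfl

theorem one_γ_inv_app (X : C₀) : (1 : GaloisMonoid ι₀).γ.inv.app X = 𝟙 (ι₀.obj X) := rfl

theorem mk_congr {α : C₀ ⥤ C₀} {γ γ' : ι₀ ≅ α ⋙ ι₀}
    (h : ∀ X, γ.hom.app X = γ'.hom.app X) : (⟨α, γ⟩ : GaloisMonoid ι₀) = ⟨α, γ'⟩ := by
  have : γ = γ' := by
    ext X
    exact h X
  rw [this]

/-- The absolute Galois monoid. -/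
instance : Monoid (GaloisMonoid ι₀) where
  mul_assoc a b c := mk_congr fun X => by
    have h₁ := (mul_γ_hom_app (a * b) c X).trans
      (congrArg (c.γ.hom.app X ≫ ·) (mul_γ_hom_app a b (c.α.obj X)))
    have h₂ := (mul_γ_hom_app a (b * c) X).trans
      (congrArg (· ≫ a.γ.hom.app (b.α.obj (c.α.obj X))) (mul_γ_hom_app b c X))
    exact h₁.trans ((Category.assoc _ _ _).symm.trans h₂.symm)
  one_mul a := mk_congr fun X => (mul_γ_hom_app 1 a X).trans (Category.comp_id _)
  mul_one a := mk_congr fun X => (mul_γ_hom_app a 1 X).trans (Category.id_comp _)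

end GaloisMonoid

/-- The submonoid `K_X` of the `(α, γ)` with `α X = X` and `γ X = id`. -/
def stab (ι₀ : C₀ ⥤ C) (X : C₀) : Submonoid (GaloisMonoid ι₀) where
  carrier := {a | ∃ h : a.α.obj X = X,
    a.γ.hom.app X = eqToHom (congrArg ι₀.obj h.symm : ι₀.obj X = ι₀.obj (a.α.obj X))}
  one_mem' := ⟨rfl, rfl⟩
  mul_mem' := by
    rintro a b ⟨ha, ha'⟩ ⟨hb, hb'⟩
    refine ⟨(congrArg a.α.obj hb).trans ha, ?_⟩
    have key : ∀ (Y : C₀) (hY : X = Y), a.γ.hom.app Y =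
        eqToHom (by subst hY; exact congrArg ι₀.obj ha.symm) := by
      rintro Y rfl
      exact ha'
    rw [GaloisMonoid.mul_γ_hom_app, hb', key _ hb.symm]
    exact eqToHom_trans _ _

/-- A left `M`-set is smooth if every element is fixed by `K_X` for some edge object `X`. -/
def IsSmooth (J : GrothendieckTopology C) (ι₀ : C₀ ⥤ C) :
    ObjectProperty (Action (Type w) (GaloisMonoid ι₀)) :=
  fun S => ∀ s : S.V, ∃ X : C₀, IsEdge J ι₀ X ∧ ∀ g ∈ stab ι₀ X, (S.ρ g : S.V ⟶ S.V) s = s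

/-- The category of smooth sets of the absolute Galois monoid. -/
abbrev SmoothSet (J : GrothendieckTopology C) (ι₀ : C₀ ⥤ C) :=
  (IsSmooth J ι₀).FullSubcategory

end Grid

section FiberFunctor

variable {C : Type u} [Category.{v} C] {J : GrothendieckTopology C}
  {C₀ : Type w} [PartialOrder C₀] {ι₀ : C₀ ⥤ C}

theorem edge_of_hom (hB : IsBSite J) {X Y : C₀} (hX : IsEdge J ι₀ X) (f : Y ⟶ X) :
    IsEdge J ι₀ Y := by
  intro Z g
  have h := hX Z (g ≫ f)
  rw [ι₀.map_comp] at h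
  exact ((hB.comp_iff _ _).1 h).2

/-- The edge objects are cofinal in `C₀`. -/
theorem edge_final (hB : IsBSite J) (hG : IsGrid J ι₀) : (IsEdge J ι₀).ι.op.Final := by
  have : IsCodirectedOrder C₀ := ⟨fun X Y => by
    obtain ⟨Z, ⟨f⟩, ⟨g⟩⟩ := hG.lambdaConnected X Y
    exact ⟨Z, leOfHom f, leOfHom g⟩⟩
  have : (IsEdge J ι₀).ι.Initial := by
    refine Functor.initial_of_exists_of_isCofiltered_of_fullyFaithful _ fun X => ?_
    obtain ⟨E, hE, -⟩ := hG.exists_edge (ι₀.obj X)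
    obtain ⟨Z, ⟨f⟩, ⟨g⟩⟩ := hG.lambdaConnected X E
    exact ⟨⟨Z, edge_of_hom hB hE g⟩, ⟨f⟩⟩
  infer_instance

/-- `ω(F)`: the colimit of `F (ι₀ X)` over the edge objects `X` of `C₀`. -/
noncomputable abbrev fiber (J : GrothendieckTopology C) (ι₀ : C₀ ⥤ C) (F : Cᵒᵖ ⥤ Type w) :
    Type w :=
  colimit ((IsEdge J ι₀).ι.op ⋙ ι₀.op ⋙ F)

/-- The bijection from `ω(F)` to the colimit of `F (ι₀ X)` over all objects `X` of `C₀`. -/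
noncomputable def fiberIso (hB : IsBSite J) (hG : IsGrid J ι₀) (F : Cᵒᵖ ⥤ Type w) :
    fiber J ι₀ F ≅ colimit (ι₀.op ⋙ F) :=
  haveI := edge_final hB hG
  Functor.Final.colimitIso (IsEdge J ι₀).ι.op (ι₀.op ⋙ F)

/-- The maps `(γ_X⁻¹)^* : F (ι₀ X) → F (ι₀ (α X))`. -/
def pullInv (F : Cᵒᵖ ⥤ Type w) (a : GaloisMonoid ι₀) :
    ι₀.op ⋙ F ⟶ a.α.op ⋙ ι₀.op ⋙ F :=
  Functor.whiskerRight (NatTrans.op a.γ.inv) F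

/-- The action of `a = (α, γ)` on `ω(F)`: apply `(γ⁻¹)^*`, regard the result in the colimit over
all of `C₀`, and go back to `ω(F)`. -/
noncomputable def act (hB : IsBSite J) (hG : IsGrid J ι₀) (F : Cᵒᵖ ⥤ Type w)
    (a : GaloisMonoid ι₀) : fiber J ι₀ F ⟶ fiber J ι₀ F :=
  colimMap (Functor.whiskerLeft (IsEdge J ι₀).ι.op (pullInv F a)) ≫
    colimit.pre (ι₀.op ⋙ F) ((IsEdge J ι₀).ι.op ⋙ a.α.op) ≫ (fiberIso hB hG F).inv

/-- The analogous self-map of the colimit over all of `C₀`. -/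
noncomputable def actAll (F : Cᵒᵖ ⥤ Type w) (a : GaloisMonoid ι₀) :
    colimit (ι₀.op ⋙ F) ⟶ colimit (ι₀.op ⋙ F) :=
  colimMap (pullInv F a) ≫ colimit.pre (ι₀.op ⋙ F) a.α.op

theorem ι_actAll (F : Cᵒᵖ ⥤ Type w) (a : GaloisMonoid ι₀) (X : C₀) :
    colimit.ι (ι₀.op ⋙ F) (op X) ≫ actAll F a =
      F.map (a.γ.inv.app X).op ≫ colimit.ι (ι₀.op ⋙ F) (op (a.α.obj X)) := by
  unfold actAll
  rw [ι_colimMap_assoc, colimit.ι_pre]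
  rfl

theorem ι_fiberIso_hom (hB : IsBSite J) (hG : IsGrid J ι₀) (F : Cᵒᵖ ⥤ Type w)
    (X : (IsEdge J ι₀).FullSubcategory) :
    colimit.ι ((IsEdge J ι₀).ι.op ⋙ ι₀.op ⋙ F) (op X) ≫ (fiberIso hB hG F).hom =
      colimit.ι (ι₀.op ⋙ F) (op X.obj) :=
  colimit.ι_pre (ι₀.op ⋙ F) (IsEdge J ι₀).ι.op (op X)

theorem ι_act (hB : IsBSite J) (hG : IsGrid J ι₀) (F : Cᵒᵖ ⥤ Type w)
    (a : GaloisMonoid ι₀) (X : (IsEdge J ι₀).FullSubcategory) :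
    colimit.ι ((IsEdge J ι₀).ι.op ⋙ ι₀.op ⋙ F) (op X) ≫ act hB hG F a =
      F.map (a.γ.inv.app X.obj).op ≫ colimit.ι (ι₀.op ⋙ F) (op (a.α.obj X.obj)) ≫
        (fiberIso hB hG F).inv := by
  unfold act
  rw [ι_colimMap_assoc]
  have h := colimit.ι_pre (ι₀.op ⋙ F) ((IsEdge J ι₀).ι.op ⋙ a.α.op) (op X)
  exact congrArg (fun t => F.map (a.γ.inv.app X.obj).op ≫ t ≫ (fiberIso hB hG F).inv) h

theorem act_eq (hB : IsBSite J) (hG : IsGrid J ι₀) (F : Cᵒᵖ ⥤ Type w) (a : GaloisMonoid ι₀) :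
    act hB hG F a = (fiberIso hB hG F).hom ≫ actAll F a ≫ (fiberIso hB hG F).inv := by
  refine colimit.hom_ext fun X => ?_
  refine (ι_act hB hG F a X.unop).trans ?_
  rw [← Category.assoc (colimit.ι _ X)]
  have h := ι_fiberIso_hom hB hG F X.unop
  refine Eq.trans ?_ (congrArg (· ≫ actAll F a ≫ (fiberIso hB hG F).inv) h).symm
  have h' := congrArg (· ≫ (fiberIso hB hG F).inv) (ι_actAll F a X.unop.obj)
  simp only [Category.assoc] at h'
  exact h'.symm

theorem actAll_one (F : Cᵒᵖ ⥤ Type w) : actAll F (1 : GaloisMonoid ι₀) = 𝟙 _ := by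
  refine colimit.hom_ext fun X => ?_
  refine (ι_actAll F 1 X.unop).trans ?_
  rw [GaloisMonoid.one_γ_inv_app]
  refine (congrArg (· ≫ colimit.ι (ι₀.op ⋙ F) X) (F.map_id (op (ι₀.obj X.unop)))).trans ?_
  exact (Category.id_comp _).trans (Category.comp_id _).symm

theorem actAll_mul (F : Cᵒᵖ ⥤ Type w) (a b : GaloisMonoid ι₀) :
    actAll F (a * b) = actAll F b ≫ actAll F a := by
  refine colimit.hom_ext fun X => ?_
  refine (ι_actAll F (a * b) X.unop).trans ?_
  have h₁ := congrArg (· ≫ actAll F a) (ι_actAll F b X.unop)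
  have h₂ := congrArg (F.map (b.γ.inv.app X.unop).op ≫ ·) (ι_actAll F a (b.α.obj X.unop))
  simp only [Category.assoc] at h₁
  refine Eq.trans ?_ (h₁.trans h₂).symm
  rw [GaloisMonoid.mul_γ_inv_app]
  refine (congrArg (· ≫ colimit.ι (ι₀.op ⋙ F) (op (a.α.obj (b.α.obj X.unop))))
    (F.map_comp (b.γ.inv.app X.unop).op (a.γ.inv.app (b.α.obj X.unop)).op)).trans ?_
  exact Category.assoc _ _ _

/-- The left `M`-set `ω(F)`. -/
noncomputable def fiberAction (hB : IsBSite J) (hG : IsGrid J ι₀) (F : Cᵒᵖ ⥤ Type w) :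
    Action (Type w) (GaloisMonoid ι₀) where
  V := fiber J ι₀ F
  ρ :=
    { toFun := fun a => act hB hG F a
      map_one' := by
        show act hB hG F 1 = 𝟙 _
        rw [act_eq, actAll_one, Category.id_comp, Iso.hom_inv_id]
      map_mul' := fun a b => by
        show act hB hG F (a * b) = act hB hG F b ≫ act hB hG F a
        simp only [act_eq, actAll_mul, Category.assoc, Iso.inv_hom_id_assoc] }

theorem fiberAction_smooth (hB : IsBSite J) (hG : IsGrid J ι₀) (F : Cᵒᵖ ⥤ Type w) :
    IsSmooth J ι₀ (fiberAction hB hG F) := by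
  intro s
  obtain ⟨X, x, rfl⟩ := Types.jointly_surjective' s
  refine ⟨X.unop.obj, X.unop.property, ?_⟩
  rintro a ⟨h, h'⟩
  have key : ∀ (Y : C₀) (hY : X.unop.obj = Y) (q : ι₀.obj Y ⟶ ι₀.obj X.unop.obj),
      q = eqToHom (congrArg ι₀.obj hY.symm) →
      F.map q.op ≫ colimit.ι (ι₀.op ⋙ F) (op Y) = colimit.ι (ι₀.op ⋙ F) (op X.unop.obj) := by
    rintro Y rfl q rfl
    exact (congrArg (· ≫ colimit.ι (ι₀.op ⋙ F) (op X.unop.obj))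
      (F.map_id (op (ι₀.obj X.unop.obj)))).trans (Category.id_comp _)
  have hq : a.γ.inv.app X.unop.obj = eqToHom (congrArg ι₀.obj h) := by
    have hi := Iso.hom_inv_id_app a.γ X.unop.obj
    rw [h'] at hi
    have hi' := congrArg (eqToHom (congrArg ι₀.obj h) ≫ ·) hi
    simp only [eqToHom_trans_assoc, eqToHom_refl, Category.id_comp] at hi'
    exact hi'.trans (Category.comp_id _)
  have e : colimit.ι ((IsEdge J ι₀).ι.op ⋙ ι₀.op ⋙ F) X ≫ act hB hG F a =
      colimit.ι ((IsEdge J ι₀).ι.op ⋙ ι₀.op ⋙ F) X := by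
    refine (ι_act hB hG F a X.unop).trans ?_
    rw [← Category.assoc]
    refine (congrArg (· ≫ (fiberIso hB hG F).inv) (key _ h.symm _ hq)).trans ?_
    rw [Iso.comp_inv_eq]
    exact (ι_fiberIso_hom hB hG F X.unop).symm
  exact ConcreteCategory.congr_hom e x

/-- The map `ω(F) → ω(F')` induced by a morphism of presheaves. -/
noncomputable def fiberMap (J : GrothendieckTopology C) (ι₀ : C₀ ⥤ C) {F F' : Cᵒᵖ ⥤ Type w}
    (t : F ⟶ F') : fiber J ι₀ F ⟶ fiber J ι₀ F' :=
  colimMap (Functor.whiskerLeft (IsEdge J ι₀).ι.op (Functor.whiskerLeft ι₀.op t))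

theorem ι_fiberMap (J : GrothendieckTopology C) (ι₀ : C₀ ⥤ C) {F F' : Cᵒᵖ ⥤ Type w}
    (t : F ⟶ F') (X : (IsEdge J ι₀).FullSubcategory) :
    colimit.ι ((IsEdge J ι₀).ι.op ⋙ ι₀.op ⋙ F) (op X) ≫ fiberMap J ι₀ t =
      t.app (op (ι₀.obj X.obj)) ≫ colimit.ι ((IsEdge J ι₀).ι.op ⋙ ι₀.op ⋙ F') (op X) :=
  ι_colimMap _ _

theorem fiberMap_act (hB : IsBSite J) (hG : IsGrid J ι₀) {F F' : Cᵒᵖ ⥤ Type w} (t : F ⟶ F')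
    (a : GaloisMonoid ι₀) :
    act hB hG F a ≫ fiberMap J ι₀ t = fiberMap J ι₀ t ≫ act hB hG F' a := by
  have hall : (fiberIso hB hG F).inv ≫ fiberMap J ι₀ t =
      colimMap (Functor.whiskerLeft ι₀.op t) ≫ (fiberIso hB hG F').inv := by
    rw [Iso.inv_comp_eq, ← Category.assoc, Iso.eq_comp_inv]
    refine colimit.hom_ext fun X => ?_
    have h₁ := congrArg (· ≫ colimMap (Functor.whiskerLeft ι₀.op t))
      (ι_fiberIso_hom hB hG F X.unop)
    simp only [Category.assoc, ι_colimMap] at h₁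
    refine Eq.trans ?_ h₁.symm
    unfold fiberMap
    rw [ι_colimMap_assoc]
    exact congrArg (t.app (op (ι₀.obj X.unop.obj)) ≫ ·) (ι_fiberIso_hom hB hG F' X.unop)
  refine colimit.hom_ext fun X => ?_
  have h₁ := congrArg (· ≫ fiberMap J ι₀ t) (ι_act hB hG F a X.unop)
  simp only [Category.assoc, hall] at h₁
  rw [ι_colimMap_assoc] at h₁
  refine h₁.trans ?_
  unfold fiberMap
  rw [ι_colimMap_assoc]
  refine Eq.trans ?_
    (congrArg (t.app (op (ι₀.obj X.unop.obj)) ≫ ·) (ι_act hB hG F' a X.unop)).symm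
  have hn := t.naturality (a.γ.inv.app X.unop.obj).op
  have hn' := congrArg (· ≫ colimit.ι (ι₀.op ⋙ F') (op (a.α.obj X.unop.obj)) ≫
    (fiberIso hB hG F').inv) hn
  simp only [Category.assoc] at hn'
  exact hn'

/-- The fiber functor on presheaves, with values in smooth sets. -/
noncomputable def presheafFiberFunctor (hB : IsBSite J) (hG : IsGrid J ι₀) :
    (Cᵒᵖ ⥤ Type w) ⥤ SmoothSet J ι₀ where
  obj F := ⟨fiberAction hB hG F, fiberAction_smooth hB hG F⟩
  map t := ObjectProperty.homMk ⟨fiberMap J ι₀ t, fun a => fiberMap_act hB hG t a⟩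
  map_id F := by
    refine ObjectProperty.hom_ext _ (Action.hom_ext _ _ ?_)
    refine colimit.hom_ext fun X => ?_
    exact (ι_colimMap _ _).trans ((Category.id_comp _).trans (Category.comp_id _).symm)
  map_comp t t' := by
    refine ObjectProperty.hom_ext _ (Action.hom_ext _ _ ?_)
    refine colimit.hom_ext fun X => ?_
    have h := congrArg (· ≫ fiberMap J ι₀ t') (ι_fiberMap J ι₀ t X.unop)
    simp only [Category.assoc] at h
    refine (ι_fiberMap J ι₀ (t ≫ t') X.unop).trans (Eq.trans ?_ h.symm)
    refine Eq.trans ?_ (congrArg (t.app _ ≫ ·) (ι_fiberMap J ι₀ t' X.unop)).symm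
    exact Category.assoc _ _ _

/-- The fiber functor `ω` from sheaves of sets on `(C, J)` to smooth sets. -/
noncomputable def fiberFunctor (hY : IsYSite.{w} J) (hG : IsGrid J ι₀) :
    Sheaf J (Type w) ⥤ SmoothSet J ι₀ :=
  sheafToPresheaf J (Type w) ⋙ presheafFiberFunctor hY.toIsBSite hG

end FiberFunctor

end YSites

/-!
A *point* of an object `X` is an object `Z` of the grid with an isomorphism `X ≅ ι₀ Z`. By the
undercategory axiom, morphisms of `C` act on points, so that a point of `X` amounts to a morphism
to `X` from the pro-object `ι₀`. The elements of the Galois monoid `M` are the endomorphisms of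
this pro-object, that is, the compatible families of points of the objects `ι₀ Z`. Such families
with a prescribed member exist by compactness when the hom sets are finite, and by successive
lifting when the grid has a countable coinitial sequence; hence `M` is transitive on the points of
each `X`. Galois coverings show that `m • p = m' • p` forces `m' = m * k` with `k` in the stabilizer
of `p`. For a sheaf `F`, the sections over `X` are then the `M`-equivariant maps from the points
of `X` to `ω(F)`, and conversely a smooth `M`-set `S` is recovered from the sheaf of equivariant
maps from points to `S`.
-/

namespace YSites

section Site

variable {C : Type u} [Category.{v} C] {J : GrothendieckTopology C}

theorem coverMor_of_isIso {X Y : C} (f : Y ⟶ X) [IsIso f] : coverMor J f := by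
  rw [coverMor, Sieve.generate_of_singleton_isSplitEpi]
  exact J.top_mem X

theorem IsATopology.exists_coverMor (hJ : IsATopology J) {X : C} {R : Sieve X} (hR : R ∈ J X) :
    ∃ (Y : C) (f : Y ⟶ X), R f ∧ coverMor J f := by
  obtain ⟨T, -, hT⟩ := hJ
  obtain ⟨Y, f, hRf, hTf⟩ := (hT X R).1 hR
  exact ⟨Y, f, hRf, (hT X _).2 ⟨Y, f, Sieve.le_generate _ _ _ Presieve.singleton.mk, hTf⟩⟩

theorem isSheafFor_singleton_of_isSheaf {F : Cᵒᵖ ⥤ Type w} (hF : Presieve.IsSheaf J F) {X Y : C}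
    {f : Y ⟶ X} (hf : coverMor J f) : (Presieve.singleton f).IsSheafFor F :=
  (Presieve.isSheafFor_iff_generate _).2 (hF _ hf)

theorem map_injective_of_isSheaf {F : Cᵒᵖ ⥤ Type w} (hF : Presieve.IsSheaf J F) {X Y : C}
    {f : Y ⟶ X} (hf : coverMor J f) : Function.Injective (F.map f.op) :=
  Presieve.isSeparatedFor_singleton.1 (isSheafFor_singleton_of_isSheaf hF hf).isSeparatedFor

theorem IsATopology.isSheaf_of_isSheafFor_singleton (hJ : IsATopology J) {F : Cᵒᵖ ⥤ Type w}
    (hF : ∀ {X Y : C} (f : Y ⟶ X), coverMor J f → (Presieve.singleton f).IsSheafFor F) :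
    Presieve.IsSheaf J F := by
  have separated {X : C} {R : Sieve X} (hR : R ∈ J X) :
      Presieve.IsSeparatedFor F (R : Presieve X) := by
    obtain ⟨Y, f, hRf, hf⟩ := hJ.exists_coverMor hR
    intro x t₁ t₂ ht₁ ht₂
    refine Presieve.isSeparatedFor_singleton.1 (hF f hf).isSeparatedFor ?_
    exact (ht₁ f hRf).trans (ht₂ f hRf).symm
  intro X R hR
  obtain ⟨Y, f, hRf, hf⟩ := hJ.exists_coverMor hR
  refine Presieve.isSheafFor_subsieve_aux F (S := Sieve.generate (Presieve.singleton f)) ?_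
    ((Presieve.isSheafFor_iff_generate _).1 (hF f hf))
    fun Y' g _ => separated (J.pullback_stable g hf)
  refine (Sieve.generate_le_iff _ _).2 ?_
  rintro _ _ ⟨⟩
  exact hRf

/-- A normal morphism `f : Y ⟶ X`: any two morphisms to `Y` with the same composite with `f`
differ by an endomorphism of `Y` over `X`. -/
def IsNormal {X Y : C} (f : Y ⟶ X) : Prop :=
  ∀ ⦃Z : C⦄ (h h' : Z ⟶ Y), h ≫ f = h' ≫ f → ∃ g : Y ⟶ Y, g ≫ f = f ∧ h ≫ g = h'

theorem IsGaloisCovering.isNormal {X Y : C} {f : Y ⟶ X} (hf : IsGaloisCovering f) :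
    IsNormal f := by
  obtain ⟨G, _, ρ, hρ⟩ := hf
  intro Z h h' e
  let := homAction ρ Z
  obtain ⟨g, hg⟩ := (hρ Z).injective h h' e
  exact ⟨(ρ g).hom.left, Over.w (ρ g).hom, hg⟩

theorem HasEnoughGalois.exists_isNormal {T : MorphismProperty C} (hT : HasEnoughGalois T)
    {X Y : C} {f : Y ⟶ X} (hf : T f) :
    ∃ (Z : C) (g : Z ⟶ Y), T (g ≫ f) ∧ IsNormal (g ≫ f) := by
  have hat_f : hat T f := ⟨Y, 𝟙 Y, by rwa [Category.id_comp]⟩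
  rw [← hT] at hat_f
  obtain ⟨Z, g, hg, hgal⟩ := hat_f
  exact ⟨Z, g, hg, hgal.isNormal⟩

end Site

section InverseSystem

theorem exists_mem_sections_of_finite_fibers {I : Type*} [Category* I] [IsCofilteredOrEmpty I]
    (P : I ⥤ Type w) {i : I} (x : P.obj i)
    (hne : ∀ {j : I} (f : j ⟶ i), ∃ y, P.map f y = x)
    (hfin : ∀ {j : I} (f : j ⟶ i), Finite {y // P.map f y = x}) :
    ∃ s ∈ P.sections, s i = x := by
  let fibers : Over i ⥤ Type w :=
    { obj := fun j => {y // P.map j.hom y = x}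
      map := fun f => ↾fun y => ⟨P.map f.left y.1, by
        rw [← P.map_comp_apply, Over.w, y.2]⟩
      map_id := fun _ => by ext y; exact P.map_id_apply _ y.1
      map_comp := fun _ _ => by ext y; exact P.map_comp_apply _ _ y.1 }
  have (j : Over i) : Nonempty (fibers.obj j) := by
    obtain ⟨y, hy⟩ := hne j.hom
    exact ⟨⟨y, hy⟩⟩
  have (j : Over i) : Finite (fibers.obj j) := hfin j.hom
  obtain ⟨t, ht⟩ := nonempty_sections_of_finite_cofiltered_system fibers
  obtain ⟨s, hs⟩ := ((Over.forget i).bijective_sectionsPrecomp P).2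
    ⟨fun j => (t j).1, fun f => congrArg Subtype.val (ht f)⟩
  refine ⟨s.1, s.2, ?_⟩
  calc s.1 i = (t (Over.mk (𝟙 i))).1 := congrArg (fun r => r.1 (Over.mk (𝟙 i))) hs
    _ = P.map (𝟙 i) (t (Over.mk (𝟙 i))).1 := (P.map_id_apply i _).symm
    _ = x := (t (Over.mk (𝟙 i))).2

theorem exists_mem_sections_of_countable_coinitial {I : Type*} [Preorder I] [IsCodirectedOrder I]
    (P : I ⥤ Type w) {z : ℕ → I} (hz : ∀ j, ∃ n, z n ≤ j) {i : I}
    (hsurj : ∀ {j k : I} (f : k ⟶ j), j ≤ i → Function.Surjective (P.map f)) (x : P.obj i) :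
    ∃ s ∈ P.sections, s i = x := by
  choose lower lower_le_left lower_le_right using fun j k : I => exists_le_le j k
  let a : ℕ → I := fun n => Nat.rec i (fun n j => lower j (z n)) n
  have ha : Antitone a := antitone_nat_of_succ_le fun n => lower_le_left _ _
  let A : ℕᵒᵖ ⥤ I := Functor.ofOpSequence (X := a) fun n => homOfLE (ha n.le_succ)
  have : A.Initial := Functor.initial_of_exists_of_isCofiltered _ (fun j => by
      obtain ⟨n, hn⟩ := hz j
      exact ⟨op (n + 1), ⟨homOfLE ((lower_le_right (a n) (z n)).trans hn)⟩⟩)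
    fun {_ c} _ _ => ⟨c, 𝟙 c, Subsingleton.elim _ _⟩
  obtain ⟨t, ht⟩ := Types.surjective_π_app_zero_of_surjective_map
    (F := A ⋙ P) (Types.limitConeIsLimit.{0, w} (A ⋙ P)) (fun n => hsurj _ (ha n.zero_le)) x
  obtain ⟨s, hs⟩ := (A.bijective_sectionsPrecomp P).2 t
  exact ⟨s.1, s.2, (congrArg (fun t => t.1 (op 0)) hs).trans ht⟩

end InverseSystem

/-- A point of `X` for the grid `ι₀ : C₀ ⥤ C`: an object of `C₀` together with an isomorphism from
`X` to its image. For a grid, these are the morphisms to `X` from the pro-object `ι₀`. -/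
structure Point {C : Type u} [Category.{v} C] {C₀ : Type w} [PartialOrder C₀] (ι₀ : C₀ ⥤ C)
    (X : C) where
  /-- the underlying object of the grid -/
  base : C₀
  /-- the identification of `X` with the image of the underlying object -/
  iso : X ≅ ι₀.obj base

namespace Point

variable {C : Type u} [Category.{v} C] {C₀ : Type w} [PartialOrder C₀] {ι₀ : C₀ ⥤ C}

/-- The tautological point of `ι₀ Z`. -/
def std (ι₀ : C₀ ⥤ C) (Z : C₀) : Point ι₀ (ι₀.obj Z) := ⟨Z, Iso.refl _⟩

/-- The morphism `f : X ⟶ Y` carries the point `p` of `X` to the point `q` of `Y`. -/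
def MapsTo {X Y : C} (f : X ⟶ Y) (p : Point ι₀ X) (q : Point ι₀ Y) : Prop :=
  ∃ h : p.base ⟶ q.base, f ≫ q.iso.hom = p.iso.hom ≫ ι₀.map h

instance (X : C) : MulAction (GaloisMonoid ι₀) (Point ι₀ X) where
  smul m p := ⟨m.α.obj p.base, p.iso ≪≫ m.γ.app p.base⟩
  one_smul p := congrArg (Point.mk p.base) (Iso.ext (Category.comp_id p.iso.hom))
  mul_smul m n p := by
    refine congrArg (Point.mk (m.α.obj (n.α.obj p.base))) (Iso.ext ?_)
    change p.iso.hom ≫ (m * n).γ.hom.app p.base =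
      (p.iso.hom ≫ n.γ.hom.app p.base) ≫ m.γ.hom.app (n.α.obj p.base)
    rw [GaloisMonoid.mul_γ_hom_app, Category.assoc]

theorem smul_iso_hom {X : C} (m : GaloisMonoid ι₀) (p : Point ι₀ X) :
    (m • p).iso.hom = p.iso.hom ≫ m.γ.hom.app p.base := rfl

theorem smul_iso_inv {X : C} (m : GaloisMonoid ι₀) (p : Point ι₀ X) :
    (m • p).iso.inv = m.γ.inv.app p.base ≫ p.iso.inv := rfl

theorem mem_stab_iff {m : GaloisMonoid ι₀} {Z : C₀} :
    m ∈ stab ι₀ Z ↔ m • std ι₀ Z = std ι₀ Z := by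
  have eq_std_iff (p : Point ι₀ (ι₀.obj Z)) : p = std ι₀ Z ↔
      ∃ h : p.base = Z, p.iso.hom = eqToHom (congrArg ι₀.obj h.symm) := by
    refine ⟨?_, ?_⟩
    · rintro rfl
      exact ⟨rfl, rfl⟩
    · obtain ⟨V, i⟩ := p
      rintro ⟨hV, h⟩
      dsimp only at hV
      subst hV
      exact congrArg (Point.mk V) (Iso.ext h)
  rw [eq_std_iff]
  exact exists_congr fun _ => ⟨(Category.id_comp _).trans, (Category.id_comp _).symm.trans⟩

namespace MapsTo

variable {X Y Z : C} {f : X ⟶ Y} {p : Point ι₀ X} {q : Point ι₀ Y}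

theorem refl (p : Point ι₀ X) : MapsTo (𝟙 X) p p :=
  ⟨𝟙 _, by rw [ι₀.map_id, Category.id_comp, Category.comp_id]⟩

theorem comp {g : Y ⟶ Z} {r : Point ι₀ Z} : MapsTo f p q → MapsTo g q r → MapsTo (f ≫ g) p r := by
  rintro ⟨h, hf⟩ ⟨h', hg⟩
  exact ⟨h ≫ h', by rw [Category.assoc, hg, reassoc_of% hf, ι₀.map_comp]⟩

theorem smul (m : GaloisMonoid ι₀) : MapsTo f p q → MapsTo f (m • p) (m • q) := by
  rintro ⟨h, hf⟩
  refine ⟨m.α.map h, ?_⟩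
  rw [smul_iso_hom, smul_iso_hom, reassoc_of% hf, Category.assoc]
  exact congrArg (p.iso.hom ≫ ·) (m.γ.hom.naturality h)

theorem std {Z V : C₀} (h : Z ⟶ V) : MapsTo (ι₀.map h) (std ι₀ Z) (std ι₀ V) :=
  ⟨h, (Category.comp_id _).trans (Category.id_comp _).symm⟩

theorem iso_inv (p : Point ι₀ X) : MapsTo p.iso.inv (Point.std ι₀ p.base) p :=
  ⟨𝟙 _, by simp [Point.std]⟩

theorem hom_unique {f' : X ⟶ Y} : MapsTo f p q → MapsTo f' p q → f = f' := by
  rintro ⟨h, hf⟩ ⟨h', hf'⟩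
  rw [← cancel_mono q.iso.hom, hf, hf', Subsingleton.elim h h']

end MapsTo

variable {J : GrothendieckTopology C} (hG : IsGrid J ι₀)

theorem exists_map_eq_of_comp_eq (hG : IsGrid J ι₀) {U Z V : C₀} (h : U ⟶ Z) (h' : U ⟶ V)
    (k : ι₀.obj Z ⟶ ι₀.obj V) (hk : ι₀.map h ≫ k = ι₀.map h') : ∃ l : Z ⟶ V, ι₀.map l = k := by
  have := hG.under_equivalence U
  let φ : (Under.post ι₀).obj (Under.mk h) ⟶ (Under.post ι₀).obj (Under.mk h') := Under.homMk k hk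
  exact ⟨((Under.post ι₀).preimage φ).right,
    congrArg CommaMorphism.right ((Under.post ι₀).map_preimage φ)⟩

theorem eq_of_comp_map_eq (hG : IsGrid J ι₀) {X : C} {p q : Point ι₀ X} (l : p.base ⟶ q.base)
    (hl : p.iso.hom ≫ ι₀.map l = q.iso.hom) : p = q := by
  obtain ⟨Z, a⟩ := p
  obtain ⟨V, b⟩ := q
  dsimp only at l hl
  obtain ⟨l', -⟩ := exists_map_eq_of_comp_eq hG l (𝟙 Z) (b.inv ≫ a.hom) (by
    rw [← cancel_epi a.hom, reassoc_of% hl, b.hom_inv_id_assoc, ι₀.map_id, Category.comp_id])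
  obtain rfl : Z = V := le_antisymm (leOfHom l) (leOfHom l')
  refine congrArg (Point.mk Z) (Iso.ext ?_)
  rwa [Subsingleton.elim l (𝟙 Z), ι₀.map_id, Category.comp_id] at hl

theorem MapsTo.unique (hG : IsGrid J ι₀) {X Y : C} {f : X ⟶ Y} {p : Point ι₀ X}
    {q q' : Point ι₀ Y} : MapsTo f p q → MapsTo f p q' → q = q' := by
  rintro ⟨h, hq⟩ ⟨h', hq'⟩
  obtain ⟨l, hl⟩ := exists_map_eq_of_comp_eq hG h h' (q.iso.inv ≫ q'.iso.hom) (by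
    rw [← cancel_epi p.iso.hom, ← hq', ← reassoc_of% hq, q.iso.hom_inv_id_assoc])
  exact eq_of_comp_map_eq hG l (by rw [hl, q.iso.hom_inv_id_assoc])

theorem exists_mapsTo (hG : IsGrid J ι₀) {X Y : C} (f : X ⟶ Y) (p : Point ι₀ X) :
    ∃ q, MapsTo f p q := by
  have := hG.under_equivalence p.base
  let A : Under (ι₀.obj p.base) := Under.mk (p.iso.inv ≫ f)
  let V : Under p.base := (Under.post ι₀).objPreimage A
  let i : (Under.post ι₀).obj V ≅ A := (Under.post ι₀).objObjPreimageIso A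
  let j : ι₀.obj V.right ≅ Y := (Under.forget _).mapIso i
  have hj : ι₀.map V.hom ≫ j.hom = p.iso.inv ≫ f := Under.w i.hom
  exact ⟨⟨V.right, j.symm⟩, V.hom, by
    rw [Iso.symm_hom, j.comp_inv_eq, Category.assoc, hj, p.iso.hom_inv_id_assoc]⟩

/-- The image of a point under a morphism. -/
noncomputable def push {X Y : C} (f : X ⟶ Y) (p : Point ι₀ X) : Point ι₀ Y :=
  (exists_mapsTo hG f p).choose

theorem mapsTo_push {X Y : C} (f : X ⟶ Y) (p : Point ι₀ X) : MapsTo f p (push hG f p) :=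
  (exists_mapsTo hG f p).choose_spec

theorem MapsTo.push_eq {X Y : C} {f : X ⟶ Y} {p : Point ι₀ X} {q : Point ι₀ Y}
    (h : MapsTo f p q) : push hG f p = q :=
  (mapsTo_push hG f p).unique hG h

theorem push_id {X : C} (p : Point ι₀ X) : push hG (𝟙 X) p = p :=
  (MapsTo.refl p).push_eq hG

theorem push_comp {X Y Z : C} (f : X ⟶ Y) (g : Y ⟶ Z) (p : Point ι₀ X) :
    push hG (f ≫ g) p = push hG g (push hG f p) :=
  ((mapsTo_push hG f p).comp (mapsTo_push hG g _)).push_eq hG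

theorem push_smul {X Y : C} (f : X ⟶ Y) (m : GaloisMonoid ι₀) (p : Point ι₀ X) :
    push hG f (m • p) = m • push hG f p :=
  ((mapsTo_push hG f p).smul m).push_eq hG

theorem push_std {Z V : C₀} (h : Z ⟶ V) : push hG (ι₀.map h) (std ι₀ Z) = std ι₀ V :=
  (MapsTo.std h).push_eq hG

theorem push_iso_inv {X : C} (p : Point ι₀ X) : push hG p.iso.inv (std ι₀ p.base) = p :=
  (MapsTo.iso_inv p).push_eq hG

theorem hom_eq_of_push_eq {X Y : C} {f f' : X ⟶ Y} {p : Point ι₀ X}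
    (h : push hG f p = push hG f' p) : f = f' := by
  have hf := mapsTo_push hG f p
  rw [h] at hf
  exact hf.hom_unique (mapsTo_push hG f' p)

theorem exists_push_std_eq {X Y : C} (p : Point ι₀ X) (q : Point ι₀ Y) :
    ∃ (U : C₀) (u : ι₀.obj U ⟶ X) (u' : ι₀.obj U ⟶ Y),
      push hG u (std ι₀ U) = p ∧ push hG u' (std ι₀ U) = q := by
  obtain ⟨U, ⟨h⟩, ⟨h'⟩⟩ := hG.lambdaConnected p.base q.base
  refine ⟨U, ι₀.map h ≫ p.iso.inv, ι₀.map h' ≫ q.iso.inv, ?_, ?_⟩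
  · rw [push_comp, push_std, push_iso_inv]
  · rw [push_comp, push_std, push_iso_inv]

theorem smul_injective (hG : IsGrid J ι₀) {X : C} (m : GaloisMonoid ι₀) :
    Function.Injective (m • · : Point ι₀ X → Point ι₀ X) := by
  intro p q h
  obtain ⟨U, u, u', rfl, rfl⟩ := exists_push_std_eq hG p q
  have hu : u = u' := hom_eq_of_push_eq hG (p := m • std ι₀ U) (by rwa [push_smul, push_smul])
  rw [hu]

theorem push_surjective {X Y : C} {f : Y ⟶ X} (hf : coverMor J f) :
    Function.Surjective (push hG f) := by
  intro p
  obtain ⟨Z, h, a, e⟩ := hG.exists_lift p.base (f ≫ p.iso.hom)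
    ((coverMor J).comp_mem _ _ hf (coverMor_of_isIso _))
  exact ⟨⟨Z, a⟩, MapsTo.push_eq hG ⟨h, e⟩⟩

theorem exists_comp_eq_of_push_eq {X Y : C} {f : Y ⟶ X} {r r' : Point ι₀ Y}
    (h : push hG f r = push hG f r') :
    ∃ (U : C₀) (u u' : ι₀.obj U ⟶ Y), u ≫ f = u' ≫ f ∧
      push hG u (std ι₀ U) = r ∧ push hG u' (std ι₀ U) = r' := by
  obtain ⟨U, u, u', rfl, rfl⟩ := exists_push_std_eq hG r r'
  rw [← push_comp, ← push_comp] at h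
  exact ⟨U, u, u', hom_eq_of_push_eq hG h, rfl, rfl⟩

theorem exists_endo_push_eq {X Y : C} {f : Y ⟶ X} (hf : IsNormal f) {r r' : Point ι₀ Y}
    (h : push hG f r = push hG f r') : ∃ g : Y ⟶ Y, g ≫ f = f ∧ push hG g r = r' := by
  obtain ⟨U, u, u', huf, rfl, rfl⟩ := exists_comp_eq_of_push_eq hG h
  obtain ⟨g, hg, rfl⟩ := hf u u' huf
  exact ⟨g, hg, (push_comp hG u g _).symm⟩

/-- The covariant functor of points. -/
noncomputable def pointFunctor : C ⥤ Type (max v w) where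
  obj X := Point ι₀ X
  map f := ↾push hG f
  map_id X := by ext p; exact push_id hG p
  map_comp f g := by ext p; exact push_comp hG f g p

/-- A point is an edge point if it lies on an edge object of the grid. -/
def Edge (J : GrothendieckTopology C) {X : C} (p : Point ι₀ X) : Prop := IsEdge J ι₀ p.base

theorem Edge.of_push (hB : IsBSite J) {X Y : C} {f : Y ⟶ X} {r : Point ι₀ Y}
    (h : Edge J (push hG f r)) : Edge J r :=
  let ⟨k, _⟩ := mapsTo_push hG f r
  edge_of_hom hB h k

theorem Edge.coverMor {X Y : C} {f : Y ⟶ X} {r : Point ι₀ Y} (h : Edge J (push hG f r)) :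
    coverMor J f := by
  obtain ⟨k, hk⟩ := mapsTo_push hG f r
  rw [← Iso.eq_comp_inv] at hk
  rw [hk]
  exact (YSites.coverMor J).comp_mem _ _ ((YSites.coverMor J).comp_mem _ _
    (coverMor_of_isIso _) (h _ k)) (coverMor_of_isIso _)

theorem exists_edge (hG : IsGrid J ι₀) (X : C) : ∃ p : Point ι₀ X, Edge J p := by
  obtain ⟨Z, hZ, ⟨i⟩⟩ := hG.exists_edge X
  exact ⟨⟨Z, i.symm⟩, hZ⟩

end Point

section Transitivity

open Point

variable {C : Type u} [Category.{v} C] {J : GrothendieckTopology C} {C₀ : Type w}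
  [PartialOrder C₀] {ι₀ : C₀ ⥤ C}

theorem GaloisMonoid.ext_of_smul_std {m m' : GaloisMonoid ι₀}
    (h : ∀ Z, m • std ι₀ Z = m' • std ι₀ Z) : m = m' := by
  obtain ⟨α, γ⟩ := m
  obtain ⟨α', γ'⟩ := m'
  obtain rfl : α = α' := CategoryTheory.Functor.ext (fun Z => congrArg Point.base (h Z))
    (fun _ _ _ => Subsingleton.elim _ _)
  refine mk_congr fun Z => ?_
  have hγ : Iso.refl _ ≪≫ γ.app Z = Iso.refl _ ≪≫ γ'.app Z := eq_of_heq (Point.mk.inj (h Z)).2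
  rw [Iso.refl_trans, Iso.refl_trans] at hγ
  exact congrArg Iso.hom hγ

theorem exists_smul_std_eq_of_mem_sections (hG : IsGrid J ι₀)
    {s : ∀ Z : C₀, Point ι₀ (ι₀.obj Z)} (hs : s ∈ (ι₀ ⋙ pointFunctor hG).sections) :
    ∃ m : GaloisMonoid ι₀, ∀ Z, m • std ι₀ Z = s Z := by
  have mapsTo {Z V : C₀} (h : Z ⟶ V) : MapsTo (ι₀.map h) (s Z) (s V) := by
    rw [← hs h]
    exact mapsTo_push hG _ _
  choose map hmap using @mapsTo
  let α : C₀ ⥤ C₀ :=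
    { obj := fun Z => (s Z).base
      map := map
      map_id := fun _ => Subsingleton.elim _ _
      map_comp := fun _ _ => Subsingleton.elim _ _ }
  let γ : ι₀ ≅ α ⋙ ι₀ := NatIso.ofComponents (fun Z => (s Z).iso) hmap
  exact ⟨⟨α, γ⟩, fun Z => congrArg (Point.mk (s Z).base) (Iso.ext (Category.id_comp _))⟩

theorem IsGrid.isCodirectedOrder (hG : IsGrid J ι₀) : IsCodirectedOrder C₀ :=
  ⟨fun Y Z => let ⟨U, ⟨h⟩, ⟨h'⟩⟩ := hG.lambdaConnected Y Z; ⟨U, leOfHom h, leOfHom h'⟩⟩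

theorem exists_isNormal_push_eq (hB : IsBSite J) (hGal : HasEnoughGalois (coverMor J))
    (hG : IsGrid J ι₀) {X Y : C} {f : Y ⟶ X} (hf : coverMor J f) (q : Point ι₀ Y) :
    ∃ (Z : C) (g : Z ⟶ Y) (r : Point ι₀ Z),
      coverMor J g ∧ IsNormal (g ≫ f) ∧ push hG g r = q := by
  obtain ⟨Z, g, hgf, hnormal⟩ := hGal.exists_isNormal hf
  have hg : coverMor J g := ((hB.comp_iff g f).1 hgf).2
  obtain ⟨r, hr⟩ := push_surjective hG hg q
  exact ⟨Z, g, r, hg, hnormal, hr⟩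

theorem finite_push_fiber (hB : IsBSite J) (hGal : HasEnoughGalois (coverMor J))
    (hG : IsGrid J ι₀) {X Y : C} {f : Y ⟶ X} (hf : coverMor J f)
    (hfin : HomFinite (Over (⟨X⟩ : CoverCat J))) (q : Point ι₀ X) :
    Finite {r // push hG f r = q} := by
  obtain ⟨r₁, rfl⟩ := push_surjective hG hf q
  obtain ⟨Z, g, r₀, hg, hnormal, rfl⟩ := exists_isNormal_push_eq hB hGal hG hf r₁
  have hgf : coverMor J (g ≫ f) := (hB.comp_iff g f).2 ⟨hf, hg⟩
  let Z' : Over (⟨X⟩ : CoverCat J) := Over.mk (Y := ⟨Z⟩) ⟨g ≫ f, hgf⟩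
  have := hfin Z' Z'
  let translate (e : Z' ⟶ Z') : {r // push hG f r = push hG f (push hG g r₀)} :=
    ⟨push hG g (push hG e.left.hom r₀), by
      have he : e.left.hom ≫ g ≫ f = g ≫ f := congrArg InducedWideCategory.Hom.hom (Over.w e)
      rw [← push_comp, ← push_comp, he, push_comp]⟩
  refine Finite.of_surjective translate fun ⟨r, hr⟩ => ?_
  obtain ⟨r', rfl⟩ := push_surjective hG hg r
  rw [← push_comp, ← push_comp] at hr
  obtain ⟨e, he, rfl⟩ := exists_endo_push_eq hG hnormal hr.symm
  have hcover : coverMor J e := ((hB.comp_iff e (g ≫ f)).1 (by rwa [he])).2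
  exact ⟨Over.homMk ⟨e, hcover⟩ (InducedWideCategory.Hom.ext he), rfl⟩

theorem exists_coinitial_seq (hB : IsBSite J) (hGal : HasEnoughGalois (coverMor J))
    (hG : IsGrid J ι₀) {Y : C₀} (hY : IsEdge J ι₀ Y)
    (hc : CountablyGenerated (Over (⟨ι₀.obj Y⟩ : CoverCat J))) :
    ∃ z : ℕ → C₀, ∀ V, ∃ n, z n ≤ V := by
  obtain ⟨S, hS, hgen⟩ := hc
  have hne : S.Nonempty := let ⟨s, hs, _⟩ := hgen (Over.mk (𝟙 _)); ⟨s, hs⟩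
  obtain ⟨s, rfl⟩ := hS.exists_eq_range hne
  choose p hp using fun n => push_surjective hG (s n).hom.property (std ι₀ Y)
  choose Z g r hg hnormal hr using fun n =>
    exists_isNormal_push_eq hB hGal hG (s n).hom.property (p n)
  -- The generators were replaced by normal covers because then any other point over `std ι₀ Y`
  -- is the image of `r n` under an endomorphism, so the choice of `r n` does not matter.
  refine ⟨fun n => (r n).base, fun V => ?_⟩
  obtain ⟨U, ⟨a⟩, ⟨b⟩⟩ := hG.lambdaConnected Y V
  obtain ⟨_, ⟨n, rfl⟩, ⟨h⟩⟩ := hgen (Over.mk (Y := ⟨ι₀.obj U⟩) ⟨ι₀.map a, hY U a⟩)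
  have hha : h.left.hom ≫ ι₀.map a = (s n).hom.hom :=
    congrArg InducedWideCategory.Hom.hom (Over.w h)
  obtain ⟨r', hr'⟩ := push_surjective hG
    ((coverMor J).comp_mem _ _ (hg n) h.left.property) (std ι₀ U)
  obtain ⟨e, -, rfl⟩ := exists_endo_push_eq hG (hnormal n) (r := r n) (r' := r') (by
    rw [push_comp, hr, hp, ← hha, ← Category.assoc, push_comp, hr', push_std])
  rw [← push_comp] at hr'
  obtain ⟨c, -⟩ := mapsTo_push hG (e ≫ g n ≫ h.left.hom) (r n)
  rw [hr'] at c
  exact ⟨n, leOfHom (c ≫ b)⟩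

/-- The orbit under the Galois monoid of every edge point of an object consists of all points of
that object. -/
def IsTransitiveOnPoints (J : GrothendieckTopology C) (ι₀ : C₀ ⥤ C) : Prop :=
  ∀ ⦃X : C⦄ ⦃p : Point ι₀ X⦄, Edge J p → ∀ q : Point ι₀ X, ∃ m : GaloisMonoid ι₀, m • p = q

theorem exists_smul_std_eq (hB : IsBSite J) (hGal : HasEnoughGalois (coverMor J))
    (hG : IsGrid J ι₀) {Y : C₀} (hY : IsEdge J ι₀ Y)
    (hcard : HomFinite (Over (⟨ι₀.obj Y⟩ : CoverCat J)) ∨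
      CountablyGenerated (Over (⟨ι₀.obj Y⟩ : CoverCat J))) (q : Point ι₀ (ι₀.obj Y)) :
    ∃ m : GaloisMonoid ι₀, m • std ι₀ Y = q := by
  have := hG.isCodirectedOrder
  obtain ⟨s, hs, rfl⟩ : ∃ s ∈ (ι₀ ⋙ pointFunctor hG).sections, s Y = q := by
    rcases hcard with hfin | hc
    · exact exists_mem_sections_of_finite_fibers (ι₀ ⋙ pointFunctor hG) q
        (fun f => push_surjective hG (hY _ f) q)
        (fun f => finite_push_fiber hB hGal hG (hY _ f) hfin q)
    · obtain ⟨z, hz⟩ := exists_coinitial_seq hB hGal hG hY hc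
      exact exists_mem_sections_of_countable_coinitial (ι₀ ⋙ pointFunctor hG) hz
        (fun f hle => push_surjective hG (edge_of_hom hB hY (homOfLE hle) _ f)) q
  obtain ⟨m, hm⟩ := exists_smul_std_eq_of_mem_sections hG hs
  exact ⟨m, hm Y⟩

theorem isTransitiveOnPoints (hB : IsBSite J) (hGal : HasEnoughGalois (coverMor J))
    (hG : IsGrid J ι₀)
    (hcard : ∀ X : CoverCat J, HomFinite (Over X) ∨ CountablyGenerated (Over X)) :
    IsTransitiveOnPoints J ι₀ := by
  intro X p hp q
  obtain ⟨m, hm⟩ := exists_smul_std_eq hB hGal hG hp (hcard _) (push hG p.iso.hom q)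
  refine ⟨m, ?_⟩
  rw [← push_iso_inv hG p, ← push_smul, hm, ← push_comp, Iso.hom_inv_id, push_id]

theorem exists_smul_eq_smul (hB : IsBSite J) (hGal : HasEnoughGalois (coverMor J))
    (hG : IsGrid J ι₀) {X : C} {p : Point ι₀ X} (hp : Edge J p) {m m' : GaloisMonoid ι₀}
    (h : m • p = m' • p) {Y : C} (q : Point ι₀ Y) : ∃ q' : Point ι₀ Y, m • q' = m' • q := by
  obtain ⟨U, u, u', rfl, rfl⟩ := exists_push_std_eq hG p q
  obtain ⟨Z, g, r, -, hnormal, hr⟩ :=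
    exists_isNormal_push_eq hB hGal hG hp.coverMor (std ι₀ U)
  obtain ⟨e, -, he⟩ := exists_endo_push_eq hG hnormal (r := m • r) (r' := m' • r) (by
    rw [push_smul, push_smul, push_comp, hr, h])
  refine ⟨push hG u' (push hG g (push hG e r)), ?_⟩
  rw [← push_smul, ← push_smul, ← push_smul, he, push_smul, push_smul, hr]

theorem exists_eq_mul_of_smul_eq (hB : IsBSite J) (hGal : HasEnoughGalois (coverMor J))
    (hG : IsGrid J ι₀) {X : C} {p : Point ι₀ X} (hp : Edge J p) {m m' : GaloisMonoid ι₀}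
    (h : m • p = m' • p) : ∃ k : GaloisMonoid ι₀, k • p = p ∧ m' = m * k := by
  choose s hs using fun Z => exists_smul_eq_smul hB hGal hG hp h (std ι₀ Z)
  obtain ⟨k, hk⟩ := exists_smul_std_eq_of_mem_sections hG (s := s) fun {Z V} l => by
    refine smul_injective hG m ?_
    change m • push hG (ι₀.map l) (s Z) = m • s V
    rw [← push_smul, hs, hs, push_smul, push_std]
  obtain rfl : m' = m * k := GaloisMonoid.ext_of_smul_std fun Z => by rw [mul_smul, hk, hs]
  exact ⟨k, smul_injective hG m ((mul_smul m k p).symm.trans h.symm), rfl⟩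

end Transitivity

section Germ

open Point

variable {C : Type u} [Category.{v} C] {J : GrothendieckTopology C} {C₀ : Type w}
  [PartialOrder C₀] {ι₀ : C₀ ⥤ C} (hB : IsBSite J) (hG : IsGrid J ι₀)

/-- The class in `ω(F)` of a section of `F` over `X`, at a point of `X`. -/
noncomputable def germ (F : Cᵒᵖ ⥤ Type w) {X : C} (p : Point ι₀ X) (x : F.obj (op X)) :
    fiber J ι₀ F :=
  (fiberIso hB hG F).inv (colimit.ι (ι₀.op ⋙ F) (op p.base) (F.map p.iso.inv.op x))

theorem ι_eq_germ (F : Cᵒᵖ ⥤ Type w) (E : (IsEdge J ι₀).FullSubcategory)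
    (x : F.obj (op (ι₀.obj E.obj))) :
    colimit.ι ((IsEdge J ι₀).ι.op ⋙ ι₀.op ⋙ F) (op E) x = germ hB hG F (std ι₀ E.obj) x := by
  have hx : F.map (std ι₀ E.obj).iso.inv.op x = x := F.map_id_apply _ x
  rw [germ, hx]
  exact ConcreteCategory.congr_hom ((Iso.eq_comp_inv _).2 (ι_fiberIso_hom hB hG F E)) x

theorem exists_germ_std_eq (F : Cᵒᵖ ⥤ Type w) (s : fiber J ι₀ F) :
    ∃ E : C₀, IsEdge J ι₀ E ∧ ∃ x, germ hB hG F (std ι₀ E) x = s := by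
  obtain ⟨E, x, rfl⟩ := Types.jointly_surjective' s
  exact ⟨E.unop.obj, E.unop.property, x, (ι_eq_germ hB hG F E.unop x).symm⟩

theorem act_germ (F : Cᵒᵖ ⥤ Type w) (m : GaloisMonoid ι₀) {X : C} (p : Point ι₀ X)
    (x : F.obj (op X)) : act hB hG F m (germ hB hG F p x) = germ hB hG F (m • p) x := by
  rw [act_eq, germ, germ, types_comp_apply, types_comp_apply, Iso.inv_hom_id_apply,
    smul_iso_inv, op_comp, F.map_comp_apply]
  exact congrArg (fiberIso hB hG F).inv
    (ConcreteCategory.congr_hom (ι_actAll F m p.base) (F.map p.iso.inv.op x))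

theorem germ_push (F : Cᵒᵖ ⥤ Type w) {X Y : C} (f : X ⟶ Y) (p : Point ι₀ X)
    (y : F.obj (op Y)) :
    germ hB hG F (push hG f p) y = germ hB hG F p (F.map f.op y) := by
  obtain ⟨h, hfh⟩ := mapsTo_push hG f p
  generalize push hG f p = q at h hfh
  have hsq : ι₀.map h ≫ q.iso.inv = p.iso.inv ≫ f := by
    rw [Iso.comp_inv_eq, Category.assoc, hfh, Iso.inv_hom_id_assoc]
  have hmap : F.map (ι₀.map h).op (F.map q.iso.inv.op y) =
      F.map p.iso.inv.op (F.map f.op y) := by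
    rw [← F.map_comp_apply, ← F.map_comp_apply, ← op_comp, ← op_comp, hsq]
  rw [germ, germ, ← hmap]
  exact congrArg (fiberIso hB hG F).inv
    (ConcreteCategory.congr_hom (colimit.w (ι₀.op ⋙ F) h.op) (F.map q.iso.inv.op y)).symm

theorem exists_edge_push_std_eq (hB : IsBSite J) (hG : IsGrid J ι₀) {X : C} (p : Point ι₀ X) :
    ∃ (E : (IsEdge J ι₀).FullSubcategory) (u : ι₀.obj E.obj ⟶ X),
      push hG u (std ι₀ E.obj) = p := by
  obtain ⟨q, hq⟩ := exists_edge hG X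
  obtain ⟨U, u, u', hu, rfl⟩ := exists_push_std_eq hG p q
  exact ⟨⟨U, hq.of_push hG hB⟩, u, hu⟩

theorem fiberMap_germ {F F' : Cᵒᵖ ⥤ Type w} (t : F ⟶ F') {X : C} (p : Point ι₀ X)
    (x : F.obj (op X)) :
    fiberMap J ι₀ t (germ hB hG F p x) = germ hB hG F' p (t.app (op X) x) := by
  obtain ⟨E, u, rfl⟩ := exists_edge_push_std_eq hB hG p
  rw [germ_push, germ_push, ← ι_eq_germ, ← NatTrans.naturality_apply, ← ι_eq_germ]
  exact ConcreteCategory.congr_hom (ι_fiberMap J ι₀ t E) (F.map u.op x)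

variable {F F' : Cᵒᵖ ⥤ Type w}

theorem germ_injective (hF : Presieve.IsSheaf J F) {X : C} {p : Point ι₀ X} (hp : Edge J p) :
    Function.Injective (germ hB hG F p) := by
  intro x x' h
  have := hG.isCodirectedOrder
  have : Nonempty C₀ := ⟨p.base⟩
  obtain ⟨U, f, f', hff'⟩ := (Types.FilteredColimit.colimit_eq_iff (ι₀.op ⋙ F)).1
    ((fiberIso hB hG F).toEquiv.symm.injective h)
  obtain rfl : f = f' := Quiver.Hom.unop_inj (Subsingleton.elim _ _)
  exact map_injective_of_isSheaf hF (coverMor_of_isIso _)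
    (map_injective_of_isSheaf hF (hp _ f.unop) hff')

/-- A section of `F` over `X` as an equivariant map from the points of `X` to `ω(F)`. -/
noncomputable def germHom {X : C} (x : F.obj (op X)) :
    Point ι₀ X →[GaloisMonoid ι₀] ToType (fiberAction hB hG F) where
  toFun p := germ hB hG F p x
  map_smul' m p := (act_germ hB hG F m p x).symm

theorem map_eq_map_of_germ_eq (hF : Presieve.IsSheaf J F) {X Y : C} {f : Y ⟶ X}
    {y : F.obj (op Y)} {φ : Point ι₀ X → fiber J ι₀ F}
    (hφ : ∀ q, germ hB hG F q y = φ (push hG f q)) {Z : C} {h h' : Z ⟶ Y}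
    (hh : h ≫ f = h' ≫ f) : F.map h.op y = F.map h'.op y := by
  obtain ⟨z, hz⟩ := exists_edge hG Z
  refine germ_injective hB hG hF hz ?_
  rw [← germ_push, ← germ_push, hφ, hφ, ← push_comp, ← push_comp, hh]

theorem germHom_surjective (hT : IsTransitiveOnPoints J ι₀) (hF : Presieve.IsSheaf J F) (X : C) :
    Function.Surjective (germHom hB hG : F.obj (op X) → _) := by
  intro φ
  obtain ⟨p, hp⟩ := exists_edge hG X
  obtain ⟨E, -, y₀, hy₀⟩ := exists_germ_std_eq hB hG F (φ p)
  obtain ⟨U, f, u, rfl, hu⟩ := exists_push_std_eq hG p (std ι₀ E)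
  rw [← hu, germ_push] at hy₀
  generalize F.map u.op y₀ = y at hy₀
  have hφ (q : Point ι₀ (ι₀.obj U)) : germ hB hG F q y = φ (push hG f q) := by
    obtain ⟨m, rfl⟩ := hT (hp.of_push hG hB) q
    rw [← act_germ, hy₀, push_smul, map_smul]
    rfl
  obtain ⟨x, rfl, -⟩ := Presieve.isSheafFor_singleton.1
    (isSheafFor_singleton_of_isSheaf hF hp.coverMor) y
    fun _ _ hh => map_eq_map_of_germ_eq hB hG hF hφ hh
  refine ⟨x, MulActionHom.ext fun q => ?_⟩
  obtain ⟨r, rfl⟩ := push_surjective hG hp.coverMor q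
  exact (germ_push hB hG F f r x).trans (hφ r)

end Germ

section FullyFaithful

open Point

variable {C : Type u} [Category.{v} C] {J : GrothendieckTopology C} {C₀ : Type w}
  [PartialOrder C₀] {ι₀ : C₀ ⥤ C} (hB : IsBSite J) (hG : IsGrid J ι₀)

theorem fiberFunctor_faithful :
    (sheafToPresheaf J (Type w) ⋙ presheafFiberFunctor hB hG).Faithful where
  map_injective {F F'} t t' h := by
    have hfib : fiberMap J ι₀ t.hom = fiberMap J ι₀ t'.hom := congrArg (fun φ => φ.hom.hom) h
    ext X x
    obtain ⟨p, hp⟩ := exists_edge hG X.unop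
    refine germ_injective hB hG ((isSheaf_iff_isSheaf_of_type _ _).1 F'.property) hp ?_
    exact (fiberMap_germ hB hG t.hom p x).symm.trans
      ((ConcreteCategory.congr_hom hfib _).trans (fiberMap_germ hB hG t'.hom p x))

theorem exists_fiberMap_eq (hT : IsTransitiveOnPoints J ι₀) {F F' : Cᵒᵖ ⥤ Type w}
    (hF' : Presieve.IsSheaf J F')
    (φ : ToType (fiberAction hB hG F) →[GaloisMonoid ι₀] ToType (fiberAction hB hG F')) :
    ∃ t : F ⟶ F', ∀ s, fiberMap J ι₀ t s = φ s := by
  choose t ht using fun (X : C) (x : F.obj (op X)) =>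
    germHom_surjective hB hG hT hF' X (φ.comp (germHom hB hG x))
  replace ht {X : C} (x : F.obj (op X)) (p : Point ι₀ X) :
      germ hB hG F' p (t X x) = φ (germ hB hG F p x) := DFunLike.congr_fun (ht X x) p
  refine ⟨{ app := fun X => ↾t X.unop, naturality := fun X Y f => ?_ }, fun s => ?_⟩
  · ext x
    obtain ⟨p, hp⟩ := exists_edge hG Y.unop
    refine germ_injective hB hG hF' hp ?_
    change germ hB hG F' p (t Y.unop (F.map f.unop.op x)) =
      germ hB hG F' p (F'.map f.unop.op (t X.unop x))
    rw [ht, ← germ_push, ← germ_push, ht]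
  · obtain ⟨E, -, x, rfl⟩ := exists_germ_std_eq hB hG F s
    exact (fiberMap_germ hB hG _ _ x).trans (ht x _)

theorem fiberFunctor_full (hT : IsTransitiveOnPoints J ι₀) :
    (sheafToPresheaf J (Type w) ⋙ presheafFiberFunctor hB hG).Full where
  map_surjective {F F'} φ := by
    obtain ⟨t, ht⟩ := exists_fiberMap_eq hB hG hT (F := F.obj)
      ((isSheaf_iff_isSheaf_of_type _ _).1 F'.property)
      ⟨φ.hom.hom, fun m s => ConcreteCategory.congr_hom (φ.hom.comm m) s⟩
    exact ⟨ObjectProperty.homMk t,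
      ObjectProperty.hom_ext _ (Action.hom_ext _ _ (ConcreteCategory.hom_ext _ _ ht))⟩

end FullyFaithful

section MulAction

variable {M A B S : Type*} [Monoid M] [MulAction M A] [MulAction M B] [MulAction M S]

theorem exists_mulActionHom_comp_eq {f : A →[M] B} (hf : Function.Surjective f) {ψ : A →[M] S}
    (hψ : Function.FactorsThrough ψ f) : ∃ φ : B →[M] S, φ.comp f = ψ := by
  have descends (a : A) : ψ (Function.surjInv hf (f a)) = ψ a := hψ (Function.surjInv_eq hf (f a))
  refine ⟨⟨fun b => ψ (Function.surjInv hf b), fun m b => ?_⟩, MulActionHom.ext descends⟩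
  obtain ⟨a, rfl⟩ := hf b
  rw [← map_smul, descends, descends, map_smul, id]

theorem exists_mulActionHom_apply_eq {a : A} {s : S} (ha : ∀ b, ∃ m : M, m • a = b)
    (hs : ∀ m m' : M, m • a = m' • a → m • s = m' • s) : ∃ φ : A →[M] S, φ a = s := by
  choose c hc using ha
  have apply_smul (m : M) : c (m • a) • s = m • s := hs _ _ (hc _)
  refine ⟨⟨fun b => c b • s, fun m b => ?_⟩, ?_⟩
  · rw [← hc b, ← mul_smul, apply_smul, apply_smul, mul_smul, id]
  · exact (congrArg (c · • s) (one_smul M a)).symm.trans ((apply_smul 1).trans (one_smul M s))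

end MulAction

section EquivariantPresheaf

open Point

variable {C : Type u} [Category.{v} C] {J : GrothendieckTopology C} {C₀ : Type w}
  [PartialOrder C₀] {ι₀ : C₀ ⥤ C} (hG : IsGrid J ι₀)

/-- `Point.push` as an equivariant map. -/
noncomputable def pushHom {X Y : C} (f : X ⟶ Y) : Point ι₀ X →[GaloisMonoid ι₀] Point ι₀ Y :=
  ⟨push hG f, fun m p => push_smul hG f m p⟩

variable (S : Type w) [MulAction (GaloisMonoid ι₀) S]

/-- The presheaf of equivariant maps from the points of an object to a set `S` with an action of
the Galois monoid. -/
noncomputable def equivariantPresheaf : Cᵒᵖ ⥤ Type (max v w) where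
  obj X := Point ι₀ X.unop →[GaloisMonoid ι₀] S
  map f := ↾fun φ => φ.comp (pushHom hG f.unop)
  map_id _ := ConcreteCategory.hom_ext _ _ fun φ => MulActionHom.ext fun p =>
    congrArg φ (push_id hG p)
  map_comp f g := ConcreteCategory.hom_ext _ _ fun φ => MulActionHom.ext fun p =>
    congrArg φ (push_comp hG g.unop f.unop p)

theorem isSheafFor_singleton_equivariantPresheaf {X Y : C} {f : Y ⟶ X} (hf : coverMor J f) :
    (Presieve.singleton f).IsSheafFor (equivariantPresheaf hG S) := by
  rw [Presieve.isSheafFor_singleton]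
  intro (ψ : Point ι₀ Y →[GaloisMonoid ι₀] S) hψ
  have factors : Function.FactorsThrough ψ (pushHom hG f) := by
    intro r r' h
    obtain ⟨U, u, u', huf, rfl, rfl⟩ := exists_comp_eq_of_push_eq hG h
    have hcomp : ψ.comp (pushHom hG u) = ψ.comp (pushHom hG u') := hψ u u' huf
    exact DFunLike.congr_fun hcomp (std ι₀ U)
  obtain ⟨φ, hφ⟩ := exists_mulActionHom_comp_eq (push_surjective hG hf) factors
  refine ⟨φ, hφ, fun φ' (hφ' : φ'.comp (pushHom hG f) = ψ) => MulActionHom.ext fun q => ?_⟩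
  obtain ⟨r, rfl⟩ := push_surjective hG hf q
  exact DFunLike.congr_fun (hφ'.trans hφ.symm) r

theorem isSheaf_equivariantPresheaf (hJ : IsATopology J) :
    Presieve.IsSheaf J (equivariantPresheaf hG S) :=
  hJ.isSheaf_of_isSheafFor_singleton fun _ hf => isSheafFor_singleton_equivariantPresheaf hG S hf

variable {S} in
theorem equivariant_ext (hT : IsTransitiveOnPoints J ι₀) {X : C} {p : Point ι₀ X} (hp : Edge J p)
    {φ φ' : Point ι₀ X →[GaloisMonoid ι₀] S} (h : φ p = φ' p) : φ = φ' := by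
  ext q
  obtain ⟨m, rfl⟩ := hT hp q
  rw [map_smul, map_smul, h]

theorem small_equivariantPresheaf (hT : IsTransitiveOnPoints J ι₀) :
    FunctorToTypes.Small.{w} (equivariantPresheaf hG S) := fun X =>
  let ⟨_, hp⟩ := exists_edge hG X.unop
  small_of_injective fun _ _ h => equivariant_ext hT hp h

variable {S}

theorem exists_equivariant_apply_eq (hB : IsBSite J) (hGal : HasEnoughGalois (coverMor J))
    (hG : IsGrid J ι₀) (hT : IsTransitiveOnPoints J ι₀) {X : C} {p : Point ι₀ X} (hp : Edge J p)
    {s : S} (hs : ∀ k : GaloisMonoid ι₀, k • p = p → k • s = s) :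
    ∃ φ : Point ι₀ X →[GaloisMonoid ι₀] S, φ p = s :=
  exists_mulActionHom_apply_eq (hT hp) fun m m' h => by
    obtain ⟨k, hk, rfl⟩ := exists_eq_mul_of_smul_eq hB hGal hG hp h
    rw [mul_smul, hs k hk]

variable [FunctorToTypes.Small.{w} (equivariantPresheaf hG S)]

variable (S) in
/-- The presheaf of equivariant maps, brought down to the universe of small sets. -/
noncomputable abbrev smallEquivariantPresheaf : Cᵒᵖ ⥤ Type w :=
  FunctorToTypes.shrink.{w} (equivariantPresheaf hG S)

variable (S) in
theorem isSheaf_smallEquivariantPresheaf (hJ : IsATopology J) :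
    Presieve.IsSheaf J (smallEquivariantPresheaf hG S) :=
  (Presieve.isSheaf_iff_of_nat_equiv (fun X => equivShrink ((equivariantPresheaf hG S).obj (op X)))
    fun _ _ f φ => congrArg (equivShrink _ <| (equivariantPresheaf hG S).map f.op ·)
      ((equivShrink _).symm_apply_apply φ).symm).1 (isSheaf_equivariantPresheaf hG S hJ)

/-- Sections of `smallEquivariantPresheaf` are equivariant maps on points. -/
noncomputable def sectionEquiv {X : C} :
    (smallEquivariantPresheaf hG S).obj (op X) ≃ (Point ι₀ X →[GaloisMonoid ι₀] S) :=
  (equivShrink ((equivariantPresheaf hG S).obj (op X))).symm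

theorem sectionEquiv_map {X Y : C} (f : X ⟶ Y)
    (x : (smallEquivariantPresheaf hG S).obj (op Y)) (p : Point ι₀ X) :
    sectionEquiv hG ((smallEquivariantPresheaf hG S).map f.op x) p =
      sectionEquiv hG x (push hG f p) :=
  DFunLike.congr_fun
    ((sectionEquiv hG).apply_symm_apply ((sectionEquiv hG x).comp (pushHom hG f))) p

variable (S) in
/-- Evaluation at the tautological points, as a cocone under the diagram defining `ω`. -/
noncomputable def evalCocone :
    Cocone ((IsEdge J ι₀).ι.op ⋙ ι₀.op ⋙ smallEquivariantPresheaf hG S) where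
  pt := S
  ι :=
    { app := fun E => ↾fun x => sectionEquiv hG x (std ι₀ E.unop.obj)
      naturality := fun _ E' f => ConcreteCategory.hom_ext _ _ fun x =>
        (sectionEquiv_map hG (ι₀.map f.unop.hom) x (std ι₀ E'.unop.obj)).trans
          (congrArg (sectionEquiv hG x) (push_std hG f.unop.hom)) }

/-- The map to `S` from `ω` of the presheaf of equivariant maps to `S`, given by evaluation. -/
noncomputable def fiberEval (x : fiber J ι₀ (smallEquivariantPresheaf hG S)) : S :=
  colimit.desc _ (evalCocone hG S) x

variable (hB : IsBSite J)

theorem fiberEval_germ {X : C} (p : Point ι₀ X)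
    (x : (smallEquivariantPresheaf hG S).obj (op X)) :
    fiberEval hG (germ hB hG _ p x) = sectionEquiv hG x p := by
  obtain ⟨E, u, rfl⟩ := exists_edge_push_std_eq hB hG p
  rw [germ_push, ← sectionEquiv_map, ← ι_eq_germ]
  exact ConcreteCategory.congr_hom (colimit.ι_desc (evalCocone hG S) (op E)) _

theorem fiberEval_act (m : GaloisMonoid ι₀)
    (s : fiber J ι₀ (smallEquivariantPresheaf hG S)) :
    fiberEval hG (act hB hG _ m s) = m • fiberEval hG s := by
  obtain ⟨E, -, x, rfl⟩ := exists_germ_std_eq hB hG _ s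
  rw [act_germ, fiberEval_germ, fiberEval_germ, map_smul]

theorem fiberEval_injective (hB : IsBSite J) (hT : IsTransitiveOnPoints J ι₀) :
    Function.Injective (fiberEval hG (S := S)) := by
  intro s s' h
  obtain ⟨E, hE, x, rfl⟩ := exists_germ_std_eq hB hG _ s
  obtain ⟨E', -, x', rfl⟩ := exists_germ_std_eq hB hG _ s'
  obtain ⟨U, u, u', hu, hu'⟩ := exists_push_std_eq hG (std ι₀ E) (std ι₀ E')
  have hU : Edge J (std ι₀ U) := Edge.of_push hG hB (f := u) (by rwa [hu])
  rw [← hu, ← hu', germ_push, germ_push] at h ⊢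
  rw [fiberEval_germ, fiberEval_germ] at h
  rw [(sectionEquiv hG).injective (equivariant_ext hT hU h)]

theorem fiberEval_surjective (hB : IsBSite J) (hGal : HasEnoughGalois (coverMor J))
    (hT : IsTransitiveOnPoints J ι₀)
    (hS : ∀ s : S, ∃ E : C₀, IsEdge J ι₀ E ∧ ∀ g ∈ stab ι₀ E, g • s = s) :
    Function.Surjective (fiberEval hG (S := S)) := by
  intro s
  obtain ⟨E, hE, hs⟩ := hS s
  obtain ⟨φ, rfl⟩ := exists_equivariant_apply_eq hB hGal hG hT (p := std ι₀ E) hE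
    fun k hk => hs k (mem_stab_iff.2 hk)
  refine ⟨germ hB hG _ (std ι₀ E) ((sectionEquiv hG).symm φ), ?_⟩
  rw [fiberEval_germ, Equiv.apply_symm_apply]

theorem fiberFunctor_essSurj (hB : IsBSite J) (hGal : HasEnoughGalois (coverMor J))
    (hG : IsGrid J ι₀) (hT : IsTransitiveOnPoints J ι₀) :
    (sheafToPresheaf J (Type w) ⋙ presheafFiberFunctor hB hG).EssSurj where
  mem_essImage S := by
    have := small_equivariantPresheaf hG (ToType S.obj) hT
    let F : Sheaf J (Type w) := ⟨smallEquivariantPresheaf hG (ToType S.obj),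
      (isSheaf_iff_isSheaf_of_type _ _).2 (isSheaf_smallEquivariantPresheaf hG _ hB.isATopology)⟩
    let e : fiber J ι₀ F.obj ≅ S.obj.V := (Equiv.ofBijective (fiberEval hG (S := ToType S.obj))
      ⟨fiberEval_injective hG hB hT, fiberEval_surjective hG hB hGal hT S.property⟩).toIso
    refine ⟨F, ⟨(IsSmooth J ι₀).isoMk (Action.mkIso e fun m => ?_)⟩⟩
    exact ConcreteCategory.hom_ext _ _ fun x => fiberEval_act hG hB m x

end EquivariantPresheaf

end YSites

theorem theorem5p1_general {C : Type u} [Category.{v} C] (J : GrothendieckTopology C)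
    (hB : YSites.IsBSite J) (hGal : YSites.HasEnoughGalois (YSites.coverMor J))
    {C₀ : Type w} [PartialOrder C₀] (ι₀ : C₀ ⥤ C) (hG : YSites.IsGrid J ι₀) :
    (sheafToPresheaf J (Type w) ⋙ YSites.presheafFiberFunctor hB hG).Faithful ∧
      ((∀ X : YSites.CoverCat J,
          YSites.HomFinite (Over X) ∨ YSites.CountablyGenerated (Over X)) →
        (sheafToPresheaf J (Type w) ⋙ YSites.presheafFiberFunctor hB hG).IsEquivalence) := by
  have faithful := YSites.fiberFunctor_faithful hB hG
  refine ⟨faithful, fun hcard => ?_⟩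
  have hT := YSites.isTransitiveOnPoints hB hGal hG hcard
  exact
    { faithful
      full := YSites.fiberFunctor_full hB hG hT
      essSurj := YSites.fiberFunctor_essSurj hB hGal hG hT }

theorem theorem5p1 {C : Type u} [Category.{v} C] (J : GrothendieckTopology C)
    (hY : YSites.IsYSite.{w} J) {C₀ : Type w} [PartialOrder C₀] (ι₀ : C₀ ⥤ C)
    (hG : YSites.IsGrid J ι₀) :
    (YSites.fiberFunctor hY hG).Faithful ∧
      ((∀ X : YSites.CoverCat J,
          YSites.HomFinite (Over X) ∨ YSites.CountablyGenerated (Over X)) →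
        (YSites.fiberFunctor hY hG).IsEquivalence) :=
  theorem5p1_general J hY.toIsBSite hY.enoughGalois ι₀ hG
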